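/- Let $H$ be a complex Hilbert space, let $D\subset H$ be a dense linear subspace and let $\mathfrak a\colon D\times D\to\mathbb C$ be a sesquilinear form (linear in the first argument). A form $\mathfrak b$ with form domain $D(\mathfrak b)$ is called sectorial if there are a vertex $\gamma\in\mathbb R$ and a semi-angle $\theta\in[0,\frac{\pi}{2})$ such that $\mathfrak b(u,u)-\gamma\|u\|_H^2\in\Sigma_\theta=\{z\in\mathbb C: z=0\text{ or }|\arg z|\le\theta\}$ for all $u\in D(\mathfrak b)$; for such $\gamma$ put $\|u\|_{\mathfrak b}^2=\operatorname{Re}\mathfrak b(u,u)+(1-\gamma)\|u\|_H^2$. The form $\mathfrak b$ is closed if it is sectorial and $(D(\mathfrak b),\|\cdot\|_{\mathfrak b})$ is complete, and closable if it has a closed extension. The operator $B$ in $H$ associated with a densely defined sectorial form $\mathfrak b$ is given as follows: for $x,f\in H$, one has $x\in D(B)$ and $Bx=f$ if and only if there is a sequence $(u_n)$ in $D(\mathfrak b)$ such that $u_n\to x$ in $H$, $\sup_n\operatorname{Re}\mathfrak b(u_n,u_n)<\infty$ and $\mathfrak b(u_n,v)\to(f,v)_H$ for all $v\in D(\mathfrak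 b)$. The regular part $\mathfrak b_{\mathrm{reg}}$ of $\mathfrak b$ is the unique closable sectorial form with form domain $D(\mathfrak b)$ that has the same associated operator as $\mathfrak b$. Suppose that $\mathfrak a$ is sectorial with vertex $\gamma$. Let $(V,\Phi)$ be the completion of $(D,\|\cdot\|_{\mathfrak a})$, that is, $V$ is a Hilbert space and $\Phi\colon D\to V$ is linear and isometric with dense range. Let $\tilde{\mathfrak a}\colon V\times V\to\mathbb C$ and $\tilde j\colon V\to H$ be the continuous extensions of $\mathfrak a$ and of the embedding of $D$ into $H$, so that $\tilde{\mathfrak a}(\Phi(u),\Phi(v))=\mathfrak a(u,v)$ and $\tilde j(\Phi(u))=u$ for all $u,v\in D$. Put $$\tilde{\mathfrak h}(u,v)=\tfrac12\bigl(\tilde{\mathfrak a}(u,v)+\overline{\tilde{\mathfrak a}(v,u)}\bigr),\qquad (\operatorname{Im}\tilde{\mathfrak a})(u,v)=\tfrac1{2i}\bigl(\tilde{\mathfrak a}(u,v)-\overline{\tilde{\mathfrak a}(v,u)}\bigr).$$ Let $V_1=\ker\tilde j$, let $\pi_1$ be the orthogonal projection of $V$ onto $V_1$, let $\pi_2=I_V-\pi_1$,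 and let $T\in\mathcal L(V,V_1)$ be the unique operator with $(\operatorname{Im}\tilde{\mathfrak a})(u,v)=\tilde{\mathfrak h}(Tu,v)$ for all $u\in V$ and $v\in V_1$. Then the singular part $\mathfrak a_{\mathrm s}=\mathfrak a-\mathfrak a_{\mathrm{reg}}$ is sectorial if and only if there exists $M>0$ such that $$\|T\pi_2\Phi(u)\|_V^2\le M\|u\|_H^2\qquad\text{for all }u\in D.$$ -/

import Mathlib

open Filter Topology
open scoped ComplexConjugate

/-- A sesquilinear form in `H` with form domain `D`, linear in the first and conjugate-linear in the
second argument. -/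
abbrev SesqForm {H : Type*} [NormedAddCommGroup H] [InnerProductSpace ℂ H]
    (D : Submodule ℂ H) : Type _ :=
  D →ₗ[ℂ] D →ₗ⋆[ℂ] ℂ

/-- The closed sector `Σ_θ` in the complex plane. -/
def sector (θ : ℝ) : Set ℂ := {z | z = 0 ∨ |Complex.arg z| ≤ θ}

/-- The real part of a sesquilinear form, `(Re b)(u, v) = (b(u, v) + conj b(v, u)) / 2`. -/
noncomputable def formRe {X : Type*} (b : X → X → ℂ) (u v : X) : ℂ :=
  (b u v + conj (b v u)) / 2

/-- The imaginary part of a sesquilinear form, `(Im b)(u, v) = (b(u, v) - conj b(v, u)) / (2i)`. -/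
noncomputable def formIm {X : Type*} (b : X → X → ℂ) (u v : X) : ℂ :=
  (b u v - conj (b v u)) / (2 * Complex.I)

namespace SesqForm

section

variable {H : Type*} [NormedAddCommGroup H] [InnerProductSpace ℂ H]

/-- `γ` is a vertex of `b`: for some semi-angle `θ ∈ [0, π/2)` all values `b(u, u) - γ ‖u‖²` lie in
the sector `Σ_θ`. -/
def IsVertex {D : Submodule ℂ H} (b : SesqForm D) (γ : ℝ) : Prop :=
  ∃ θ : ℝ, 0 ≤ θ ∧ θ < Real.pi / 2 ∧
    ∀ u : D, b u u - ((γ * ‖(u : H)‖ ^ 2 : ℝ) : ℂ) ∈ sector θ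

/-- A form is sectorial if it has a vertex. -/
def IsSectorial {D : Submodule ℂ H} (b : SesqForm D) : Prop :=
  ∃ γ : ℝ, IsVertex b γ

/-- The square of the form norm, `‖u‖_b² = (Re b)(u, u) + (1 - γ) ‖u‖²`. The value `(Re b)(u, u)`
is the real number `Re (b(u, u))`. -/
noncomputable def normSq {D : Submodule ℂ H} (b : SesqForm D) (γ : ℝ) (u : D) : ℝ :=
  (b u u).re + (1 - γ) * ‖(u : H)‖ ^ 2

/-- A sectorial form is closed if its domain is complete for the form norm (different vertices give
equivalent form norms). -/
def IsClosed {D : Submodule ℂ H} (b : SesqForm D) : Prop :=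
  ∃ γ : ℝ, IsVertex b γ ∧
    ∀ u : ℕ → D,
      Tendsto (fun p : ℕ × ℕ => normSq b γ (u p.1 - u p.2)) atTop (𝓝 0) →
      ∃ x : D, Tendsto (fun n => normSq b γ (u n - x)) atTop (𝓝 0)

/-- The form `c` extends the form `b`. -/
def Extends {D E : Submodule ℂ H} (c : SesqForm E) (b : SesqForm D) : Prop :=
  ∃ h : D ≤ E, ∀ u v : D, c (Submodule.inclusion h u) (Submodule.inclusion h v) = b u v

/-- A sectorial form is closable if it has a closed (sectorial) extension. -/
def IsClosable {D : Submodule ℂ H} (b : SesqForm D) : Prop :=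
  ∃ (E : Submodule ℂ H) (c : SesqForm E), Extends c b ∧ IsClosed c

/-- The graph of the operator `B` associated with a densely defined sectorial form `b` (not
necessarily closable), following Arendt and ter Elst: `x ∈ D(B)` and `B x = f` if and only if there
is a sequence `uₙ` in `D(b)` with `uₙ → x` in `H`, `sup Re b(uₙ, uₙ) < ∞` and
`b(uₙ, v) → (f, v)_H` for all `v ∈ D(b)`. -/
def OperatorGraph {D : Submodule ℂ H} (b : SesqForm D) (x f : H) : Prop :=
  ∃ u : ℕ → D,
    Tendsto (fun n => (u n : H)) atTop (𝓝 x) ∧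
    BddAbove (Set.range fun n => (b (u n) (u n)).re) ∧
    ∀ v : D, Tendsto (fun n => b (u n) v) atTop (𝓝 (inner ℂ (v : H) f))

/-- `b` is a closable sectorial form with the same form domain as `a` and with the same associated
operator. -/
def IsRegularPart {D : Submodule ℂ H} (a b : SesqForm D) : Prop :=
  IsSectorial b ∧ IsClosable b ∧ ∀ x f : H, OperatorGraph a x f ↔ OperatorGraph b x f

/-- The regular part of a densely defined sectorial form: the unique closable sectorial form with
the same form domain and the same associated operator. -/
noncomputable def regularPart {D : Submodule ℂ H} (a : SesqForm D) : SesqForm D :=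
  Classical.epsilon fun b : SesqForm D => IsRegularPart a b

/-- The singular part `a - a_reg`. -/
noncomputable def singularPart {D : Submodule ℂ H} (a : SesqForm D) : SesqForm D :=
  a - regularPart a

/-- `(V, Φ)` is the completion of the form domain for the form norm of `a` with vertex `γ`: the
linear map `Φ` is isometric with dense range (and `V` is a Hilbert space). -/
def IsCompletion {D : Submodule ℂ H} (a : SesqForm D) (γ : ℝ)
    {V : Type*} [NormedAddCommGroup V] [InnerProductSpace ℂ V] [CompleteSpace V]
    (Φ : D →ₗ[ℂ] V) : Prop :=
  (∀ u : D, ‖Φ u‖ ^ 2 = normSq a γ u) ∧ DenseRange Φ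

end

end SesqForm

/-!
A sectorial form `a` is studied through the operator `A` on the completion `V` of its domain with
`ã(u, v) = ⟪v, A u⟫`, and through the map `j : V → H`, whose kernel measures the failure of
closability.

Shifting `A` by a multiple of `j† j` gives an operator that is coercive, hence invertible. This shows
that the operator associated with `a` consists of the pairs `(j w, f)` with `A w = j† f`
(`Represents.operatorGraph_iff`), and that such `w` are dense in `V` if `j` is injective
(`IsElliptic.dense_core`). A closable form is represented on a space for which `j` is injective;
on the dense set of these `w` the form is given by the operator, so that two closable forms with the
same operator are equal (`SesqForm.IsClosable.eq_of_operatorGraph`).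

`A` is coercive on `ker j`, so `V` is the direct sum of `ker j` and of its `A`-orthogonal
complement `W`. On `W` the map `j` is injective, and restricting `ã` to `W` does not change
the operator. Hence, with `Q` the projection onto `ker j` along `W`, the regular part of `a` is
`ã((1 - Q) Φ u, (1 - Q) Φ v)` (`IsKernelProjection.regularPart_apply`), and
`a_s(u, u) = ã(Q Φ u, Φ u)`.

Let `y` be orthogonal to `ker j`. Then `‖Q y‖` and `‖T y‖` are comparable, and
`Re ã(Q y, y) = -‖Q y‖²` (`IsKernelProjection.of_orthogonal`). If `a_s` is sectorial, its lower bound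
extends by density to `Re ã(Q x, x) ≥ δ ‖j x‖²` on `V`; at `x = π₂ Φ u` it reads
`‖Q x‖² ≤ -δ ‖u‖²`, which is the bound on `T`. Conversely, with `p = π₁ Φ u` and `t = T π₂ Φ u`,
`a_s(u, u)` differs from `ã(p, p)`, whose real part is `‖p‖²`, by at most `2 ‖p‖ ‖t‖ + ‖t‖²`; if
`‖t‖² ≤ M ‖u‖²`, a shift by a multiple of `M ‖u‖²` absorbs this error.
-/

open InnerProductSpace

/-! ### Sectors and polarization -/

theorem abs_im_le_of_mem_sector {θ : ℝ} (h1 : θ < Real.pi / 2) {z : ℂ}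
    (hz : z ∈ sector θ) : |z.im| ≤ Real.tan θ * z.re := by
  rcases hz with rfl | hz
  · simp
  have hlt : |z.arg| < Real.pi / 2 := hz.trans_lt h1
  rcases Complex.abs_arg_lt_pi_div_two_iff.1 hlt with hre | rfl
  · have htan : |z.im / z.re| ≤ Real.tan θ := by
      rw [← Complex.tan_arg, abs_le]
      have hz' := abs_le.1 hz
      have hl := abs_lt.1 hlt
      have h1' : -(Real.pi / 2) < -θ := by linarith
      constructor
      · rw [← Real.tan_neg]
        exact Real.strictMonoOn_tan.monotoneOn
          ⟨h1', by linarith [hz'.1, hl.2]⟩ ⟨hl.1, hl.2⟩ hz'.1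
      · exact Real.strictMonoOn_tan.monotoneOn
          ⟨hl.1, hl.2⟩ ⟨by linarith [hz'.2, hl.1], h1⟩ hz'.2
    rwa [abs_div, abs_of_pos hre, div_le_iff₀ hre] at htan
  · simp

theorem mem_sector_arctan {K : ℝ} {z : ℂ} (hz : |z.im| ≤ K * z.re) (hre : 0 ≤ z.re) :
    z ∈ sector (Real.arctan K) := by
  rcases hre.eq_or_lt with h0 | hpos
  · left
    rw [← h0, mul_zero] at hz
    exact Complex.ext h0.symm (abs_nonpos_iff.1 hz)
  · right
    have hlt : |z.arg| < Real.pi / 2 := Complex.abs_arg_lt_pi_div_two_iff.2 (Or.inl hpos)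
    have hl := abs_lt.1 hlt
    have hq : |z.im / z.re| ≤ K := by
      rwa [abs_div, abs_of_pos hpos, div_le_iff₀ hpos]
    have harg : z.arg = Real.arctan (z.im / z.re) := by
      rw [← Complex.tan_arg, Real.arctan_tan hl.1 hl.2]
    rw [harg, abs_le, ← Real.arctan_neg]
    exact ⟨Real.arctan_strictMono.monotone (abs_le.1 hq).1,
      Real.arctan_strictMono.monotone (abs_le.1 hq).2⟩

/-- Polarization for a form that is linear in the first argument. -/
theorem four_mul_sesq {X : Type*} [AddCommGroup X] [Module ℂ X] (b : X →ₗ[ℂ] X →ₗ⋆[ℂ] ℂ)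
    (u v : X) :
    4 * b u v = b (u + v) (u + v) - b (u - v) (u - v)
      + Complex.I * b (u + Complex.I • v) (u + Complex.I • v)
      - Complex.I * b (u - Complex.I • v) (u - Complex.I • v) := by
  simp only [map_add, map_sub, LinearMap.add_apply, LinearMap.sub_apply, map_smul,
    LinearMap.smul_apply, LinearMap.map_smulₛₗ, smul_eq_mul, Complex.conj_I]
  linear_combination (2 * b u v - 2 * b v u) * Complex.I_sq

theorem sesq_ext {X : Type*} [AddCommGroup X] [Module ℂ X] {b c : X →ₗ[ℂ] X →ₗ⋆[ℂ] ℂ}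
    (h : ∀ u, b u u = c u u) : b = c := by
  ext u v
  have h4 : (4 : ℂ) * b u v = 4 * c u v := by simp only [four_mul_sesq, h]
  exact mul_left_cancel₀ (by norm_num) h4

/-- A sesquilinear form that is bounded on the diagonal is bounded. -/
theorem norm_sesq_le {X : Type*} [NormedAddCommGroup X] [NormedSpace ℂ X]
    (b : X →ₗ[ℂ] X →ₗ⋆[ℂ] ℂ) {C : ℝ} (hb : ∀ u, ‖b u u‖ ≤ C * ‖u‖ ^ 2) (u v : X) :
    ‖b u v‖ ≤ 4 * C * ‖u‖ * ‖v‖ := by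
  by_cases hu : u = 0
  · simp [hu]
  by_cases hv : v = 0
  · simp [hv]
  have hu' : 0 < ‖u‖ := norm_pos_iff.2 hu
  have hv' : 0 < ‖v‖ := norm_pos_iff.2 hv
  have hC : 0 ≤ C := by
    by_contra h
    have := (norm_nonneg _).trans (hb u)
    have : 0 < ‖u‖ ^ 2 := by positivity
    nlinarith
  have key : ∀ x y : X, ‖x‖ = 1 → ‖y‖ = 1 → ‖b x y‖ ≤ 4 * C := by
    intro x y hx hy
    have bnd : ∀ z : X, ‖z‖ ≤ 2 → ‖b z z‖ ≤ 4 * C := fun z hz =>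
      (hb z).trans (by
        have hz2 : ‖z‖ ^ 2 ≤ 4 := by nlinarith [norm_nonneg z]
        nlinarith)
    have hIy : ‖Complex.I • y‖ = 1 := by simp [norm_smul, hy]
    have e1 := bnd (x + y) ((norm_add_le _ _).trans (by linarith))
    have e2 := bnd (x - y) ((norm_sub_le _ _).trans (by linarith))
    have e3 := bnd (x + Complex.I • y) ((norm_add_le _ _).trans (by linarith))
    have e4 := bnd (x - Complex.I • y) ((norm_sub_le _ _).trans (by linarith))
    have h4 : 4 * ‖b x y‖ = ‖4 * b x y‖ := by simp
    have h5 : 4 * ‖b x y‖ ≤ 16 * C := by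
      rw [h4, four_mul_sesq]
      refine (norm_sub_le _ _).trans ?_
      refine (add_le_add_left ((norm_add_le _ _).trans
        (add_le_add_left (norm_sub_le _ _) _)) _).trans ?_
      simp only [norm_mul, Complex.norm_I, one_mul]
      linarith
    linarith
  have hk := key ((‖u‖⁻¹ : ℂ) • u) ((‖v‖⁻¹ : ℂ) • v)
    (by simp [norm_smul, hu'.ne']) (by simp [norm_smul, hv'.ne'])
  have e : b u v = (‖u‖ * ‖v‖ : ℂ) * b ((‖u‖⁻¹ : ℂ) • u) ((‖v‖⁻¹ : ℂ) • v) := by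
    have h1 : (‖u‖ : ℂ) ≠ 0 := by exact_mod_cast hu'.ne'
    have h2 : (‖v‖ : ℂ) ≠ 0 := by exact_mod_cast hv'.ne'
    simp only [map_smul, LinearMap.smul_apply, LinearMap.map_smulₛₗ, smul_eq_mul, map_inv₀,
      Complex.conj_ofReal]
    field_simp
  rw [e, norm_mul, norm_mul, Complex.norm_real, Complex.norm_real, norm_norm, norm_norm]
  calc ‖u‖ * ‖v‖ * _ ≤ ‖u‖ * ‖v‖ * (4 * C) := by gcongr
    _ = _ := by ring

section

variable {H : Type*} [NormedAddCommGroup H] [InnerProductSpace ℂ H]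

/-- The sector condition as real inequalities; `K` plays the role of `tan θ`. -/
theorem SesqForm.isVertex_iff {D : Submodule ℂ H} {b : SesqForm D} {γ : ℝ} :
    b.IsVertex γ ↔ ∃ K : ℝ, ∀ u : D, 0 ≤ (b u u).re - γ * ‖(u : H)‖ ^ 2 ∧
      |(b u u).im| ≤ K * ((b u u).re - γ * ‖(u : H)‖ ^ 2) := by
  constructor
  · rintro ⟨θ, -, h1, h⟩
    refine ⟨Real.tan θ, fun u => ?_⟩
    have hre : 0 ≤ (b u u - ((γ * ‖(u : H)‖ ^ 2 : ℝ) : ℂ)).re := by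
      rcases h u with h' | h'
      · rw [h', Complex.zero_re]
      · exact Complex.abs_arg_le_pi_div_two_iff.1 (h'.trans h1.le)
    have him := abs_im_le_of_mem_sector h1 (h u)
    rw [Complex.sub_re, Complex.ofReal_re] at hre him
    rw [Complex.sub_im, Complex.ofReal_im, sub_zero] at him
    exact ⟨hre, him⟩
  · rintro ⟨K, h⟩
    refine ⟨Real.arctan (max K 0), Real.arctan_nonneg.2 (le_max_right _ _),
      Real.arctan_lt_pi_div_two _, fun u => mem_sector_arctan ?_ ?_⟩
    · rw [Complex.sub_re, Complex.ofReal_re, Complex.sub_im, Complex.ofReal_im, sub_zero]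
      exact (h u).2.trans (mul_le_mul_of_nonneg_right (le_max_left _ _) (h u).1)
    · rw [Complex.sub_re, Complex.ofReal_re]
      exact (h u).1

end

/-! ### Bounded elliptic operators and completed forms -/

section

open ContinuousLinearMap

variable {H : Type*} [NormedAddCommGroup H] [InnerProductSpace ℂ H]
variable {V : Type*} [NormedAddCommGroup V] [InnerProductSpace ℂ V]

/-- The operator `A` on `V` represents, through `⟪v, A u⟫`, a bounded form which is `j`-elliptic in
a normalized way: the norm of `V` is the form norm for the vertex `γ`, where vectors of `V` are
measured in `H` through `j`, and `γ` is a vertex. The map `j` need not be injective. -/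
structure IsElliptic (A : V →L[ℂ] V) (j : V →L[ℂ] H) (γ : ℝ) : Prop where
  norm_sq : ∀ w, ‖w‖ ^ 2 = (inner ℂ w (A w)).re + (1 - γ) * ‖j w‖ ^ 2
  sectorial : ∃ K : ℝ, ∀ w, 0 ≤ (inner ℂ w (A w)).re - γ * ‖j w‖ ^ 2 ∧
    |(inner ℂ w (A w)).im| ≤ K * ((inner ℂ w (A w)).re - γ * ‖j w‖ ^ 2)

/-- `Φ` embeds the form domain `D` densely into `V` in such a way that `A` and `j` extend the form
`b` and the embedding of `D` into `H`. -/
structure Represents {D : Submodule ℂ H} (b : SesqForm D) (Φ : D →ₗ[ℂ] V) (A : V →L[ℂ] V)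
    (j : V →L[ℂ] H) : Prop where
  dense : DenseRange Φ
  form : ∀ u v, inner ℂ (Φ v) (A (Φ u)) = b u v
  emb : ∀ u, j (Φ u) = u

theorem isUnit_of_norm_sq_le [CompleteSpace V] {A : V →L[ℂ] V}
    (hA : ∀ w, ‖w‖ ^ 2 ≤ (inner ℂ w (A w)).re) : IsUnit A := by
  refine isUnit_of_forall_le_norm_inner_map A (c := 1) one_pos fun w => ?_
  rw [NNReal.coe_one, mul_one, norm_inner_symm]
  exact (hA w).trans (Complex.re_le_norm _)

namespace IsElliptic

variable {A : V →L[ℂ] V} {j : V →L[ℂ] H} {γ : ℝ}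

/-- Ellipticity is inherited by closed subspaces, with the compression of the operator. -/
theorem restrict (h : IsElliptic A j γ) (K : Submodule ℂ V) [K.HasOrthogonalProjection] :
    IsElliptic (K.orthogonalProjectionOnto ∘L A ∘L K.subtypeL) (j ∘L K.subtypeL) γ := by
  have e : ∀ w : K, inner ℂ w ((K.orthogonalProjectionOnto ∘L A ∘L K.subtypeL) w)
      = inner ℂ (w : V) (A w) := fun w => by
    exact Submodule.inner_orthogonalProjectionOnto_eq_of_mem_left w _
  obtain ⟨C, hC⟩ := h.sectorial
  refine ⟨fun w => ?_, C, fun w => ?_⟩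
  · rw [e]; exact h.norm_sq w
  · rw [e]; exact hC w

variable [CompleteSpace V]

/-- The shifted operator has real part the identity, by the norm identity. -/
theorem isUnit_shift [CompleteSpace H] (h : IsElliptic A j γ) :
    IsUnit (A + ((1 - γ : ℝ) : ℂ) • (j.adjoint ∘L j)) := by
  refine isUnit_of_norm_sq_le fun w => ?_
  rw [h.norm_sq, add_apply, inner_add_right, smul_apply, inner_smul_right, coe_comp,
    Function.comp_apply, adjoint_inner_right, inner_self_eq_norm_sq_to_K, Complex.add_re,
    Complex.re_ofReal_mul]
  refine le_of_eq ?_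
  congr 2
  norm_cast

/-- The numerical identity for the norm polarizes to an identity of operators. -/
theorem polarized [CompleteSpace H] (h : IsElliptic A j γ) (u v : V) :
    inner ℂ v (A u) + inner ℂ (A v) u + 2 * (1 - γ : ℝ) * inner ℂ (j v) (j u)
      = 2 * inner ℂ v u := by
  have hz : ((A + A.adjoint + (2 * (1 - γ : ℝ) : ℂ) • (j.adjoint ∘L j) -
      (2 : ℂ) • ContinuousLinearMap.id ℂ V : V →L[ℂ] V) : V →ₗ[ℂ] V) = 0 := by
    rw [← inner_map_self_eq_zero]
    intro x
    rw [← inner_conj_symm, map_eq_zero]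
    have h1 : inner ℂ x (A x) + inner ℂ (A x) x = (2 * (inner ℂ x (A x)).re : ℝ) := by
      rw [← inner_conj_symm (A x) x, Complex.add_conj]
    have h2 : inner ℂ (j x) (j x) = ((‖j x‖ ^ 2 : ℝ) : ℂ) := by
      rw [inner_self_eq_norm_sq_to_K]; norm_cast
    have h3 : inner ℂ x x = ((‖x‖ ^ 2 : ℝ) : ℂ) := by
      rw [inner_self_eq_norm_sq_to_K]; norm_cast
    simp only [coe_coe, sub_apply, add_apply, smul_apply, coe_comp, Function.comp_apply,
      coe_id', id_eq, inner_sub_right, inner_add_right, inner_smul_right, adjoint_inner_right,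
      h1, h2, h3]
    rw [h.norm_sq x]
    push_cast
    ring
  have hv := congrArg (fun B : V →ₗ[ℂ] V => inner ℂ v (B u)) hz
  simp only [coe_coe, sub_apply, add_apply, smul_apply, coe_comp, Function.comp_apply,
    coe_id', id_eq, inner_sub_right, inner_add_right, inner_smul_right, adjoint_inner_right,
    LinearMap.zero_apply, inner_zero_right] at hv
  linear_combination hv

/-- If `j` is injective, the vectors `w` with `A w ∈ j† H` are dense: the operator associated with
the form has a form core as domain. -/
theorem dense_core [CompleteSpace H] (h : IsElliptic A j γ) (hj : Function.Injective j) (w : V) :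
    ∃ (f : ℕ → H) (u : ℕ → V), (∀ n, A (u n) = j.adjoint (f n)) ∧ Tendsto u atTop (𝓝 w) := by
  obtain ⟨U, hU⟩ := h.isUnit_shift
  set B := A + ((1 - γ : ℝ) : ℂ) • (j.adjoint ∘L j) with hB
  have hUB : ∀ x, B ((↑U⁻¹ : V →L[ℂ] V) x) = x := fun x => by
    rw [← hU, ← mul_apply_eq_comp, U.mul_inv]; rfl
  have hBU : ∀ x, (↑U⁻¹ : V →L[ℂ] V) (B x) = x := fun x => by
    rw [← hU, ← mul_apply_eq_comp, U.inv_mul]; rfl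
  have hd : DenseRange j.adjoint := by
    have := (Submodule.topologicalClosure_eq_top_iff (K := j.adjoint.range)).2 (by
      rw [orthogonal_range, adjoint_adjoint]
      exact LinearMap.ker_eq_bot.2 hj)
    exact Submodule.dense_iff_topologicalClosure_eq_top.2 this
  obtain ⟨g, hg, hgl⟩ := mem_closure_iff_seq_limit.1 (hd (B w))
  choose f hf using hg
  refine ⟨fun n => f n - ((1 - γ : ℝ) : ℂ) • j ((↑U⁻¹ : V →L[ℂ] V) (g n)),
    fun n => (↑U⁻¹ : V →L[ℂ] V) (g n), fun n => ?_, ?_⟩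
  · have := hUB (g n)
    rw [hB, add_apply, smul_apply, coe_comp, Function.comp_apply] at this
    rw [map_sub, map_smul, hf]
    exact eq_sub_of_add_eq this
  · have := ((↑U⁻¹ : V →L[ℂ] V).continuous.tendsto (B w)).comp hgl
    rwa [hBU] at this

/-- If `j` is injective, the form carried over to `j V` is a closed form. -/
theorem isClosable_of_represents (h : IsElliptic A j γ) (hj : Function.Injective j)
    {D : Submodule ℂ H} {b : SesqForm D} {Φ : D →ₗ[ℂ] V} (hb : Represents b Φ A j) :
    b.IsClosable := by
  let e : V ≃ₗ[ℂ] LinearMap.range (j : V →ₗ[ℂ] H) := LinearEquiv.ofInjective (j : V →ₗ[ℂ] H) hj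
  have he : ∀ x, j (e.symm x) = x := fun x =>
    congrArg Subtype.val (e.apply_symm_apply x)
  let c : SesqForm (LinearMap.range (j : V →ₗ[ℂ] H)) := LinearMap.mk₂'ₛₗ _ _
    (fun x y => inner ℂ (e.symm y) (A (e.symm x)))
    (fun x x' y => by simp)
    (fun r x y => by simp)
    (fun x y y' => by simp)
    (fun r x y => by simp [mul_comm])
  have hc : ∀ x y, c x y = inner ℂ (e.symm y) (A (e.symm x)) := fun _ _ => rfl
  have hn : ∀ x, c.normSq γ x = ‖e.symm x‖ ^ 2 := fun x => by
    rw [h.norm_sq, SesqForm.normSq, he, hc]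
  have hle : D ≤ LinearMap.range (j : V →ₗ[ℂ] H) := fun u hu => ⟨Φ ⟨u, hu⟩, hb.emb ⟨u, hu⟩⟩
  refine ⟨_, c, ⟨hle, ?_⟩, γ, SesqForm.isVertex_iff.2 ?_, ?_⟩
  · intro u v
    have hi : ∀ u : D, e.symm (Submodule.inclusion hle u) = Φ u := fun u => hj (by
      rw [he, hb.emb, Submodule.coe_inclusion])
    rw [hc, ← hb.form, hi, hi]
  · obtain ⟨K, hK⟩ := h.sectorial
    refine ⟨K, fun x => ?_⟩
    rw [hc, ← he x]
    exact hK _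
  · intro u hu
    have hcau : CauchySeq fun n => e.symm (u n) := by
      rw [cauchySeq_iff_tendsto_dist_atTop_0]
      have := hu.sqrt
      simp only [hn, Real.sqrt_zero, norm_nonneg, Real.sqrt_sq] at this
      simpa only [dist_eq_norm, map_sub] using this
    obtain ⟨w, hw⟩ := cauchySeq_tendsto_of_complete hcau
    refine ⟨e w, ?_⟩
    have := (tendsto_iff_norm_sub_tendsto_zero.1 hw).pow 2
    simpa only [hn, map_sub, LinearEquiv.symm_apply_apply, ne_eq, OfNat.ofNat_ne_zero,
      not_false_eq_true, zero_pow] using this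

end IsElliptic

/-- The operator associated with a form is read off the completed form. -/
theorem Represents.operatorGraph_iff [CompleteSpace H] [CompleteSpace V] {A : V →L[ℂ] V}
    {j : V →L[ℂ] H} {γ : ℝ} {D : Submodule ℂ H} {b : SesqForm D} {Φ : D →ₗ[ℂ] V}
    (hb : Represents b Φ A j) (h : IsElliptic A j γ) (x f : H) :
    b.OperatorGraph x f ↔ ∃ w : V, j w = x ∧ A w = j.adjoint f := by
  constructor
  · rintro ⟨u, hux, ⟨C, hC⟩, huf⟩
    have hU := h.isUnit_shift
    set B := A + ((1 - γ : ℝ) : ℂ) • (j.adjoint ∘L j) with hB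
    obtain ⟨w, hw⟩ := (isUnit_iff_bijective.1 hU).2 (j.adjoint (f + ((1 - γ : ℝ) : ℂ) • x))
    -- `Φ (u n)` is bounded in `V`
    obtain ⟨R, hR⟩ : ∃ R, ∀ n, ‖Φ (u n)‖ ≤ R := by
      obtain ⟨M, hM⟩ := (Metric.isBounded_range_of_tendsto _ hux).exists_norm_le
      refine ⟨√(C + |1 - γ| * M ^ 2), fun n => Real.le_sqrt_of_sq_le ?_⟩
      have h1 : (b (u n) (u n)).re ≤ C := hC ⟨n, rfl⟩
      have h2 : ‖(u n : H)‖ ≤ M := hM _ ⟨n, rfl⟩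
      rw [h.norm_sq, hb.form, hb.emb]
      have h3 : (1 - γ) * ‖(u n : H)‖ ^ 2 ≤ |1 - γ| * M ^ 2 :=
        mul_le_mul (le_abs_self _) (by gcongr) (by positivity) (abs_nonneg _)
      linarith
    -- testing `B (Φ (u n) - w)` against the dense range of `Φ`
    have hlim : ∀ v : V, Tendsto (fun n => inner ℂ v (B (Φ (u n) - w))) atTop (𝓝 0) := by
      intro v
      have hBd : ∀ n, ‖B (Φ (u n) - w)‖ ≤ ‖B‖ * (R + ‖w‖) := fun n =>
        (B.le_opNorm _).trans (by gcongr; exact (norm_sub_le _ _).trans (by gcongr; exact hR n))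
      set S := ‖B‖ * (R + ‖w‖) with hS
      have hS0 : 0 ≤ S := (norm_nonneg _).trans (hBd 0)
      rw [Metric.tendsto_atTop]
      intro ε hε
      obtain ⟨d, hd⟩ := hb.dense.exists_dist_lt v (ε := ε / (2 * (S + 1))) (by positivity)
      have hdl : Tendsto (fun n => inner ℂ (Φ d) (B (Φ (u n) - w))) atTop (𝓝 0) := by
        have e : ∀ n, inner ℂ (Φ d) (B (Φ (u n) - w)) = b (u n) d - inner ℂ (d : H) f
            + ((1 - γ : ℝ) : ℂ) * inner ℂ (d : H) ((u n : H) - x) := fun n => by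
          rw [map_sub, hw, hB, inner_sub_right, add_apply, inner_add_right, hb.form, smul_apply,
            inner_smul_right, coe_comp, Function.comp_apply, adjoint_inner_right,
            adjoint_inner_right, hb.emb, hb.emb, inner_add_right, inner_smul_right,
            inner_sub_right]
          ring
        simp only [e]
        have t1 := (huf d).sub_const (inner ℂ (d : H) f)
        have t2 := ((tendsto_const_nhds (x := (d : H))).inner (𝕜 := ℂ)
          (hux.sub_const x)).const_mul ((1 - γ : ℝ) : ℂ)
        simpa only [sub_self, inner_zero_right, mul_zero, add_zero] using t1.add t2
      obtain ⟨N, hN⟩ := Metric.tendsto_atTop.1 hdl (ε / 2) (by positivity)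
      refine ⟨N, fun n hn => ?_⟩
      have hN' := hN n hn
      rw [dist_zero_right] at hN' ⊢
      have e : inner ℂ v (B (Φ (u n) - w)) = inner ℂ (v - Φ d) (B (Φ (u n) - w))
          + inner ℂ (Φ d) (B (Φ (u n) - w)) := by rw [← inner_add_left, sub_add_cancel]
      have h5 : ‖inner ℂ (v - Φ d) (B (Φ (u n) - w))‖ ≤ ε / 2 := by
        refine (norm_inner_le_norm _ _).trans ?_
        rw [dist_eq_norm] at hd
        calc ‖v - Φ d‖ * ‖B (Φ (u n) - w)‖ ≤ ε / (2 * (S + 1)) * (S + 1) := by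
              gcongr
              linarith [hBd n]
          _ = ε / 2 := by field_simp
      rw [e]
      linarith [norm_add_le (inner ℂ (v - Φ d) (B (Φ (u n) - w)))
        (inner ℂ (Φ d) (B (Φ (u n) - w)))]
    -- the adjoint of `B` is onto, so `Φ (u n) - w` tends to zero weakly
    have hBs : Function.Surjective B.adjoint := by
      have : IsUnit B.adjoint := by
        rw [← star_eq_adjoint]; exact hU.star
      exact (isUnit_iff_bijective.1 this).2
    have hjw : j w = x := by
      have key : ∀ g : H, inner ℂ g (x - j w) = 0 := fun g => by
        obtain ⟨v, hv⟩ := hBs (j.adjoint g)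
        have h1 := hlim v
        have e : ∀ n, inner ℂ v (B (Φ (u n) - w)) = inner ℂ g ((u n : H) - j w) := fun n => by
          rw [← adjoint_inner_left, hv, adjoint_inner_left, map_sub, hb.emb]
        simp only [e] at h1
        exact tendsto_nhds_unique
          ((tendsto_const_nhds (x := g)).inner (𝕜 := ℂ) (hux.sub_const (j w))) h1
      exact (sub_eq_zero.1 (inner_self_eq_zero.1 (key (x - j w)))).symm
    refine ⟨w, hjw, ?_⟩
    rw [hB, add_apply, smul_apply, coe_comp, Function.comp_apply, hjw, map_add, map_smul] at hw
    exact add_right_cancel hw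
  · rintro ⟨w, rfl, hf⟩
    obtain ⟨g, hg, hgl⟩ := mem_closure_iff_seq_limit.1 (hb.dense w)
    choose u hu using hg
    have hgu : Tendsto (fun n => Φ (u n)) atTop (𝓝 w) := by simpa only [hu] using hgl
    refine ⟨u, ?_, ?_, fun v => ?_⟩
    · have := (j.continuous.tendsto w).comp hgu
      simpa only [Function.comp_def, hb.emb] using this
    · have : Tendsto (fun n => (b (u n) (u n)).re) atTop (𝓝 (inner ℂ w (A w)).re) := by
        simp only [← hb.form]
        exact (Complex.continuous_re.tendsto _).comp
          (hgu.inner ((A.continuous.tendsto w).comp hgu))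
      exact this.bddAbove_range
    · have := (tendsto_const_nhds (x := Φ v)).inner (𝕜 := ℂ) ((A.continuous.tendsto w).comp hgu)
      simp only [Function.comp_def, hb.form, hf, adjoint_inner_right, hb.emb] at this
      exact this

end

/-! ### Uniqueness of the regular part -/

universe u

section

variable {H : Type u} [NormedAddCommGroup H] [InnerProductSpace ℂ H]

/-- A copy of the form domain, without the norm inherited from `H`, to carry the form norm. -/
def FormDomain (E : Submodule ℂ H) : Type u := E

instance (E : Submodule ℂ H) : AddCommGroup (FormDomain E) := inferInstanceAs (AddCommGroup E)

instance (E : Submodule ℂ H) : Module ℂ (FormDomain E) := inferInstanceAs (Module ℂ E)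

/-- The inner product `Re c + (1 - γ) (·, ·)_H` on the domain of a sectorial form with
vertex `γ`. -/
@[reducible]
noncomputable def SesqForm.innerCore {E : Submodule ℂ H} (c : SesqForm E) {γ : ℝ}
    (hγ : c.IsVertex γ) : InnerProductSpace.Core ℂ (FormDomain E) where
  inner u v := (c v u + conj (c u v)) / 2 + (1 - γ : ℝ) * inner ℂ (u : E).1 (v : E).1
  conj_inner_symm u v := by
    simp only [map_add, map_div₀, map_mul, Complex.conj_conj, Complex.conj_ofReal,
      inner_conj_symm, Complex.conj_ofNat]
    ring
  re_inner_nonneg u := by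
    obtain ⟨K, hK⟩ := SesqForm.isVertex_iff.1 hγ
    have h1 := (hK u).1
    rw [Complex.add_conj, inner_self_eq_norm_sq_to_K]
    have : ((2 * (c u u).re : ℝ) : ℂ) / 2 + ((1 - γ : ℝ) : ℂ) * ((‖(u : E).1‖ : ℝ) : ℂ) ^ 2
      = (((c u u).re + (1 - γ) * ‖(u : E).1‖ ^ 2 : ℝ) : ℂ) := by push_cast; ring
    refine le_of_le_of_eq ?_ (congrArg Complex.re this.symm)
    rw [Complex.ofReal_re]
    nlinarith [sq_nonneg ‖(u : E).1‖]
  add_left u v w := by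
    have h1 : c w (u + v) = c w u + c w v := map_add (c w) u v
    have h2 : c (u + v) w = c u w + c v w := LinearMap.map_add₂ c u v w
    have h3 : inner ℂ ((u + v : FormDomain E) : E).1 (w : E).1
      = inner ℂ (u : E).1 (w : E).1 + inner ℂ (v : E).1 (w : E).1 := inner_add_left _ _ _
    rw [h1, h2, h3, map_add]
    ring
  smul_left u v r := by
    have h1 : c v (r • u) = conj r * c v u := LinearMap.map_smulₛₗ (c v) r u
    have h2 : c (r • u) v = r * c u v := LinearMap.map_smul₂ c r u v
    have h3 : inner ℂ ((r • u : FormDomain E) : E).1 (v : E).1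
      = conj r * inner ℂ (u : E).1 (v : E).1 := inner_smul_left _ _ _
    rw [h1, h2, h3, map_mul]
    ring
  definite u hu := by
    obtain ⟨K, hK⟩ := SesqForm.isVertex_iff.1 hγ
    have h1 := (hK u).1
    have : (c u u + conj (c u u)) / 2 + ((1 - γ : ℝ) : ℂ) * inner ℂ (u : E).1 (u : E).1
      = (((c u u).re + (1 - γ) * ‖(u : E).1‖ ^ 2 : ℝ) : ℂ) := by
      rw [Complex.add_conj, inner_self_eq_norm_sq_to_K]; push_cast; norm_num
    have h0 := this.symm.trans hu
    norm_cast at h0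
    have h2 : ‖(u : E).1‖ = 0 := by
      refine pow_eq_zero_iff (two_ne_zero) |>.1 (le_antisymm ?_ (sq_nonneg _))
      linarith
    exact Subtype.ext (norm_eq_zero.1 h2)

/-- The completed form of a closable form lives on a space that embeds injectively into `H`, namely
on the closure of `D` in the domain of a closed extension. -/
theorem SesqForm.IsClosable.exists_represents {D : Submodule ℂ H} {b : SesqForm D}
    (hb : b.IsClosable) :
    ∃ (V : Type u) (_ : NormedAddCommGroup V) (_ : InnerProductSpace ℂ V) (_ : CompleteSpace V)
      (Φ : D →ₗ[ℂ] V) (A : V →L[ℂ] V) (j : V →L[ℂ] H) (γ : ℝ),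
      IsElliptic A j γ ∧ Represents b Φ A j ∧ Function.Injective j := by
  obtain ⟨E, c, ⟨hle, hext⟩, γ, hγ, hcomp⟩ := hb
  let core := c.innerCore hγ
  let _ : NormedAddCommGroup (FormDomain E) := core.toNormedAddCommGroup
  let _ : InnerProductSpace ℂ (FormDomain E) := InnerProductSpace.ofCore core.toCore
  have hinner : ∀ u v : FormDomain E, inner ℂ u v
      = (c v u + conj (c u v)) / 2 + (1 - γ : ℝ) * inner ℂ (u : E).1 (v : E).1 := fun _ _ => rfl
  have hnormSq : ∀ u : FormDomain E, c.normSq γ u = (c u u).re + (1 - γ) * ‖(u : E).1‖ ^ 2 :=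
    fun _ => rfl
  have hnorm : ∀ u : FormDomain E, ‖u‖ ^ 2 = c.normSq γ u := fun u => by
    rw [← inner_self_eq_norm_sq (𝕜 := ℂ) u, hinner, Complex.add_conj, hnormSq,
      inner_self_eq_norm_sq_to_K]
    have : ((2 * (c u u).re : ℝ) : ℂ) / 2 + ((1 - γ : ℝ) : ℂ) * ((‖(u : E).1‖ : ℝ) : ℂ) ^ 2
      = (((c u u).re + (1 - γ) * ‖(u : E).1‖ ^ 2 : ℝ) : ℂ) := by push_cast; ring
    exact (congrArg Complex.re this).trans (Complex.ofReal_re _)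
  have : CompleteSpace (FormDomain E) := by
    refine Metric.complete_of_cauchySeq_tendsto fun u hu => ?_
    rw [cauchySeq_iff_tendsto_dist_atTop_0] at hu
    have h2 := hu.pow 2
    simp only [dist_eq_norm, hnorm, ne_eq, OfNat.ofNat_ne_zero, not_false_eq_true,
      zero_pow] at h2
    obtain ⟨(x : FormDomain E), hx⟩ := hcomp u h2
    refine ⟨x, tendsto_iff_norm_sub_tendsto_zero.2 ?_⟩
    have h3 : Tendsto (fun n => √(c.normSq γ (u n - x : FormDomain E))) atTop (𝓝 √0) := hx.sqrt
    simpa only [← hnorm, Real.sqrt_sq (norm_nonneg _), Real.sqrt_zero] using h3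
  obtain ⟨K, hK⟩ := SesqForm.isVertex_iff.1 hγ
  have hle1 : ∀ u : FormDomain E, ‖(u : E).1‖ ^ 2 ≤ ‖u‖ ^ 2 := fun u => by
    rw [hnorm, hnormSq]; linarith [(hK u).1]
  -- the embedding into `H`
  let j : FormDomain E →L[ℂ] H := LinearMap.mkContinuous
    (E.subtype : FormDomain E →ₗ[ℂ] H) 1 fun u => by
      rw [one_mul]; exact (sq_le_sq₀ (norm_nonneg _) (norm_nonneg _)).1 (hle1 u)
  have hj : ∀ u : FormDomain E, j u = (u : E).1 := fun _ => rfl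
  -- the form is bounded for the form norm
  have hbd : ∀ u : FormDomain E, ‖c u u‖ ≤ (1 + |γ| + |K|) * ‖u‖ ^ 2 := fun u => by
    have h1 := hK u
    have h2 := hnorm u
    rw [hnormSq] at h2
    set r := (c u u).re with hr
    set q := ‖(u : E).1‖ ^ 2 with hq
    have hq0 : 0 ≤ q := sq_nonneg _
    have hqn := hle1 u
    rw [← hq] at hqn
    have hs : r - γ * q ≤ ‖u‖ ^ 2 := by linarith
    have hγq : |γ * q| ≤ |γ| * ‖u‖ ^ 2 := by
      rw [abs_mul, abs_of_nonneg hq0]; gcongr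
    have hre : |r| ≤ (1 + |γ|) * ‖u‖ ^ 2 := by
      have := abs_add_le (r - γ * q) (γ * q)
      rw [sub_add_cancel, abs_of_nonneg h1.1] at this
      linarith
    have him : |(c u u).im| ≤ |K| * ‖u‖ ^ 2 :=
      h1.2.trans (mul_le_mul (le_abs_self K) hs h1.1 (abs_nonneg K))
    have := Complex.norm_le_abs_re_add_abs_im (c u u)
    linarith
  let c' : FormDomain E →ₗ[ℂ] FormDomain E →ₗ⋆[ℂ] ℂ := c
  let B : FormDomain E →L[ℂ] FormDomain E →L⋆[ℂ] ℂ :=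
    LinearMap.mkContinuous₂ c' _ (norm_sesq_le c' hbd)
  let A : FormDomain E →L[ℂ] FormDomain E :=
    (continuousLinearMapOfBilin (𝕜 := ℂ) B.flip).adjoint
  have hA : ∀ u v : FormDomain E, inner ℂ v (A u) = c u v := fun u v => by
    rw [ContinuousLinearMap.adjoint_inner_right, continuousLinearMapOfBilin_apply]; rfl
  have hell : IsElliptic A j γ := by
    refine ⟨fun u => ?_, K, fun u => ?_⟩
    · rw [hA, hnorm]; rfl
    · rw [hA]; exact hK u
  -- restriction to the closure of `D`
  let Φ₀ : D →ₗ[ℂ] FormDomain E := Submodule.inclusion hle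
  let W : Submodule ℂ (FormDomain E) := (LinearMap.range Φ₀).topologicalClosure
  have : CompleteSpace W := (LinearMap.range Φ₀).isClosed_topologicalClosure.completeSpace_coe
  let Φ : D →ₗ[ℂ] W := Φ₀.codRestrict W fun u =>
    (LinearMap.range Φ₀).le_topologicalClosure ⟨u, rfl⟩
  refine ⟨W, inferInstance, inferInstance, inferInstance, Φ, _, _, γ, hell.restrict W,
    ⟨?_, fun u v => ?_, fun u => rfl⟩, ?_⟩
  · intro w
    have hw : (w : FormDomain E) ∈ closure (Set.range Φ₀) := w.2
    rw [closure_subtype]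
    refine closure_mono ?_ hw
    rintro _ ⟨u, rfl⟩
    exact ⟨Φ u, ⟨u, rfl⟩, rfl⟩
  · exact (Submodule.inner_orthogonalProjectionOnto_eq_of_mem_left (Φ v) _).trans
      ((hA _ _).trans (hext u v))
  · intro x y hxy
    exact Subtype.ext (Subtype.ext hxy)

/-- On pairs with the same image in `H` and the same value of the associated operator, the forms
agree, hence the two form norms are comparable. -/
theorem IsElliptic.norm_sq_le_of_operator_eq [CompleteSpace H]
    {V : Type*} [NormedAddCommGroup V] [InnerProductSpace ℂ V] [CompleteSpace V]
    {V' : Type*} [NormedAddCommGroup V'] [InnerProductSpace ℂ V'] [CompleteSpace V']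
    {A : V →L[ℂ] V} {j : V →L[ℂ] H} {γ : ℝ} {A' : V' →L[ℂ] V'} {j' : V' →L[ℂ] H} {γ' : ℝ}
    (h : IsElliptic A j γ) (h' : IsElliptic A' j' γ') {w : V} {w' : V'} {f : H}
    (hj : j' w' = j w) (hA : A w = j.adjoint f) (hA' : A' w' = j'.adjoint f) :
    ‖w'‖ ^ 2 ≤ (1 + |γ - γ'| * ‖j‖ ^ 2) * ‖w‖ ^ 2 := by
  have h1 := h.norm_sq w
  have h2 := h'.norm_sq w'
  rw [hA, ContinuousLinearMap.adjoint_inner_right] at h1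
  rw [hA', ContinuousLinearMap.adjoint_inner_right, hj] at h2
  have h3 : ‖j w‖ ^ 2 ≤ ‖j‖ ^ 2 * ‖w‖ ^ 2 := by
    rw [← mul_pow]; gcongr; exact j.le_opNorm w
  have h4 : (γ - γ') * ‖j w‖ ^ 2 ≤ |γ - γ'| * (‖j‖ ^ 2 * ‖w‖ ^ 2) :=
    mul_le_mul (le_abs_self _) h3 (sq_nonneg _) (abs_nonneg _)
  linarith

/-- A closable form is determined by its associated operator. -/
theorem SesqForm.IsClosable.eq_of_operatorGraph [CompleteSpace H] {D : Submodule ℂ H}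
    {b b' : SesqForm D} (hb : b.IsClosable) (hb' : b'.IsClosable)
    (hg : ∀ x f : H, b.OperatorGraph x f ↔ b'.OperatorGraph x f) : b = b' := by
  obtain ⟨V, _, _, _, Φ, A, j, γ, hA, hr, hj⟩ := hb.exists_represents
  obtain ⟨V', _, _, _, Φ', A', j', γ', hA', hr', hj'⟩ := hb'.exists_represents
  refine sesq_ext fun u => ?_
  obtain ⟨f, w, hw, hlim⟩ := hA.dense_core hj (Φ u)
  have hex : ∀ n, ∃ w' : V', j' w' = j (w n) ∧ A' w' = j'.adjoint (f n) := fun n =>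
    (hr'.operatorGraph_iff hA' _ _).1 ((hg _ _).1
      ((hr.operatorGraph_iff hA _ _).2 ⟨w n, rfl, hw n⟩))
  choose w' hjw hw' using hex
  have hcau : CauchySeq w' := by
    rw [cauchySeq_iff_tendsto_dist_atTop_0]
    have h1 := cauchySeq_iff_tendsto_dist_atTop_0.1 hlim.cauchySeq
    set C := 1 + |γ - γ'| * ‖j‖ ^ 2 with hC
    have hC0 : 0 ≤ C := by positivity
    have h2 := h1.const_mul √C
    rw [mul_zero] at h2
    refine squeeze_zero (fun _ => dist_nonneg) (fun p => ?_) h2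
    rw [dist_eq_norm, dist_eq_norm]
    refine (sq_le_sq₀ (norm_nonneg _) (by positivity)).1 ?_
    rw [mul_pow, Real.sq_sqrt hC0]
    exact hA.norm_sq_le_of_operator_eq hA' (f := f p.1 - f p.2)
      (by simp only [map_sub, hjw]) (by simp only [map_sub, hw]) (by simp only [map_sub, hw'])
  obtain ⟨z, hz⟩ := cauchySeq_tendsto_of_complete hcau
  have hjl : Tendsto (fun n => j (w n)) atTop (𝓝 (u : H)) := by
    have := (j.continuous.tendsto _).comp hlim
    rwa [hr.emb] at this
  have hzu : z = Φ' u := by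
    refine hj' ?_
    rw [hr'.emb]
    have := (j'.continuous.tendsto _).comp hz
    simp only [Function.comp_def, hjw] at this
    exact tendsto_nhds_unique this hjl
  subst hzu
  have l1 := hlim.inner (𝕜 := ℂ) ((A.continuous.tendsto _).comp hlim)
  have l2 := hz.inner (𝕜 := ℂ) ((A'.continuous.tendsto _).comp hz)
  simp only [Function.comp_def, hw, ContinuousLinearMap.adjoint_inner_right, hr.form] at l1
  simp only [Function.comp_def, hw', ContinuousLinearMap.adjoint_inner_right, hjw,
    hr'.form] at l2
  exact tendsto_nhds_unique l1 l2

end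

/-! ### The regular part in the completion -/

section

variable {H : Type*} [NormedAddCommGroup H] [InnerProductSpace ℂ H]
variable {V : Type*} [NormedAddCommGroup V] [InnerProductSpace ℂ V]
variable {A : V →L[ℂ] V} {j : V →L[ℂ] H} {γ : ℝ}

/-- `Q` maps into `ker j`, and `Q x` has the same `A`-pairing with `ker j` as `x`. For elliptic `A`
it is the (in general not orthogonal) projection onto `ker j` along the `A`-orthogonal complement
of `ker j`. -/
structure IsKernelProjection (A : V →L[ℂ] V) (j : V →L[ℂ] H) (Q : V →L[ℂ] V) : Prop where
  map_eq_zero : ∀ x, j (Q x) = 0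
  inner_eq_zero : ∀ x v, j v = 0 → inner ℂ v (A (x - Q x)) = 0

namespace IsElliptic

theorem norm_sq_of_map_eq_zero (h : IsElliptic A j γ) {w : V} (hw : j w = 0) :
    ‖w‖ ^ 2 = (inner ℂ w (A w)).re := by
  rw [h.norm_sq, hw]; simp

theorem eq_zero_of_inner_eq_zero (h : IsElliptic A j γ) {w : V} (hw : j w = 0)
    (h0 : inner ℂ w (A w) = 0) : w = 0 := by
  have := h.norm_sq_of_map_eq_zero hw
  rw [h0, Complex.zero_re] at this
  exact norm_eq_zero.1 ((pow_eq_zero_iff two_ne_zero).1 this)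

/-- Since `A` is coercive on `ker j`, its compression to `ker j` is invertible; composing the inverse
with the orthogonal projection of `A x` gives `Q x`. -/
theorem exists_isKernelProjection [CompleteSpace V] (h : IsElliptic A j γ) :
    ∃ Q, IsKernelProjection A j Q := by
  have hr := h.restrict j.ker
  set A₁ := j.ker.orthogonalProjectionOnto ∘L A ∘L j.ker.subtypeL with hA₁
  have hunit : IsUnit A₁ := isUnit_of_norm_sq_le fun w =>
    (hr.norm_sq_of_map_eq_zero w.2).le
  obtain ⟨U, hU⟩ := hunit
  refine ⟨j.ker.subtypeL ∘L (↑U⁻¹ : j.ker →L[ℂ] j.ker) ∘L j.ker.orthogonalProjectionOnto ∘L A,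
    fun x => ((↑U⁻¹ : j.ker →L[ℂ] j.ker) (j.ker.orthogonalProjectionOnto (A x))).2,
    fun x v hv => ?_⟩
  set w := (↑U⁻¹ : j.ker →L[ℂ] j.ker) (j.ker.orthogonalProjectionOnto (A x)) with hw
  have hUw : A₁ w = j.ker.orthogonalProjectionOnto (A x) := by
    rw [hw, ← hU, ← mul_apply_eq_comp, U.mul_inv]; rfl
  have e : ∀ y : V, inner ℂ v y
      = inner ℂ (⟨v, hv⟩ : j.ker) (j.ker.orthogonalProjectionOnto y) := fun y =>
    (Submodule.inner_orthogonalProjectionOnto_eq_of_mem_left (⟨v, hv⟩ : j.ker) y).symm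
  rw [map_sub, inner_sub_right, e, ← hUw, sub_eq_zero]
  exact (e _).symm

end IsElliptic

namespace Represents

variable {D : Submodule ℂ H} {b : SesqForm D} {Φ : D →ₗ[ℂ] V}

theorem isElliptic_of_isVertex (hb : Represents b Φ A j)
    (hn : ∀ u, ‖Φ u‖ ^ 2 = b.normSq γ u) (hγ : b.IsVertex γ) : IsElliptic A j γ := by
  obtain ⟨K, hK⟩ := SesqForm.isVertex_iff.1 hγ
  have c1 : Continuous fun w : V => inner ℂ w (A w) := continuous_id.inner A.continuous
  have c2 : Continuous fun w : V => (inner ℂ w (A w)).re := Complex.continuous_re.comp c1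
  have c3 : Continuous fun w : V => (inner ℂ w (A w)).im := Complex.continuous_im.comp c1
  refine ⟨fun w => ?_, K, fun w => ⟨?_, ?_⟩⟩
  · refine hb.dense.induction_on w (isClosed_eq (by fun_prop) (by fun_prop)) fun u => ?_
    rw [hb.form, hb.emb, hn, SesqForm.normSq]
  · refine hb.dense.induction_on w (isClosed_le (by fun_prop) (by fun_prop)) fun u => ?_
    rw [hb.form, hb.emb]
    exact (hK u).1
  · refine hb.dense.induction_on w (isClosed_le (by fun_prop) (by fun_prop)) fun u => ?_
    rw [hb.form, hb.emb]
    exact (hK u).2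

theorem isVertex (hb : Represents b Φ A j) (h : IsElliptic A j γ) : b.IsVertex γ := by
  obtain ⟨K, hK⟩ := h.sectorial
  refine SesqForm.isVertex_iff.2 ⟨K, fun u => ?_⟩
  rw [← hb.form, ← hb.emb]
  exact hK _

end Represents

namespace IsKernelProjection

variable {Q : V →L[ℂ] V}

theorem apply_of_map_eq_zero (hQ : IsKernelProjection A j Q) (h : IsElliptic A j γ) {v : V}
    (hv : j v = 0) : Q v = v := by
  have hj : j (v - Q v) = 0 := by rw [map_sub, hv, hQ.map_eq_zero, sub_zero]
  exact (sub_eq_zero.1 (h.eq_zero_of_inner_eq_zero hj (hQ.inner_eq_zero v _ hj))).symm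

theorem apply_eq_zero (hQ : IsKernelProjection A j Q) (h : IsElliptic A j γ) {x : V}
    (hx : ∀ v, j v = 0 → inner ℂ v (A x) = 0) : Q x = 0 := by
  refine h.eq_zero_of_inner_eq_zero (hQ.map_eq_zero x) ?_
  have := hQ.inner_eq_zero x _ (hQ.map_eq_zero x)
  rwa [map_sub, inner_sub_right, hx _ (hQ.map_eq_zero x), zero_sub, neg_eq_zero] at this

variable [CompleteSpace H] [CompleteSpace V]
variable {D : Submodule ℂ H} {a : SesqForm D} {Φ : D →ₗ[ℂ] V}

/-- The regular part evaluates the extended form after projecting along `ker j`. -/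
theorem regularPart_apply (hQ : IsKernelProjection A j Q) (h : IsElliptic A j γ)
    (ha : Represents a Φ A j) (u v : D) :
    a.regularPart u v = inner ℂ (Φ v - Q (Φ v)) (A (Φ u - Q (Φ u))) := by
  -- the `A`-orthogonal complement `W` of `ker j`
  let W : Submodule ℂ V :=
    { carrier := {x | ∀ v, j v = 0 → inner ℂ v (A x) = 0}
      add_mem' := fun hx hy v hv => by rw [map_add, inner_add_right, hx v hv, hy v hv, add_zero]
      zero_mem' := fun v _ => by rw [map_zero, inner_zero_right]
      smul_mem' := fun c x hx v hv => by rw [map_smul, inner_smul_right, hx v hv, mul_zero] }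
  have hWc : IsClosed (W : Set V) := by
    have : (W : Set V) = ⋂ v, ⋂ (_ : j v = 0), {x | inner ℂ v (A x) = 0} := by
      ext x; simp [W]
    rw [this]
    exact isClosed_iInter fun v => isClosed_iInter fun _ =>
      isClosed_eq (by fun_prop) continuous_const
  have : CompleteSpace W := hWc.completeSpace_coe
  let P : V →L[ℂ] W := (ContinuousLinearMap.id ℂ V - Q).codRestrict W hQ.inner_eq_zero
  have hP : ∀ x, (P x : V) = x - Q x := fun _ => rfl
  have hPs : Function.Surjective P := fun w => ⟨w, Subtype.ext (by
    rw [hP, hQ.apply_eq_zero h w.2, sub_zero])⟩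
  let ΦW : D →ₗ[ℂ] W := (P : V →ₗ[ℂ] W) ∘ₗ Φ
  let c : SesqForm D := LinearMap.mk₂'ₛₗ _ _
    (fun u v => inner ℂ (ΦW v : V) (A (ΦW u)))
    (fun x x' y => by simp)
    (fun r x y => by simp)
    (fun x y y' => by simp)
    (fun r x y => by simp [mul_comm])
  have hrep : Represents c ΦW (W.orthogonalProjectionOnto ∘L A ∘L W.subtypeL)
      (j ∘L W.subtypeL) := by
    refine ⟨hPs.denseRange.comp ha.dense P.continuous, fun u v => ?_, fun u => ?_⟩
    · exact Submodule.inner_orthogonalProjectionOnto_eq_of_mem_left (ΦW v) _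
    · change j (Φ u - Q (Φ u)) = u
      rw [map_sub, hQ.map_eq_zero, sub_zero, ha.emb]
  have hW := h.restrict W
  have hinj : Function.Injective (j ∘L W.subtypeL) := by
    refine (injective_iff_map_eq_zero _).2 fun w hw => Subtype.ext ?_
    exact h.eq_zero_of_inner_eq_zero hw (w.2 _ hw)
  have hgraph : ∀ x f : H, a.OperatorGraph x f ↔ c.OperatorGraph x f := by
    intro x f
    rw [ha.operatorGraph_iff h, hrep.operatorGraph_iff hW]
    constructor
    · rintro ⟨w, hw, hf⟩
      have hwW : w ∈ W := fun v hv => by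
        rw [hf, ContinuousLinearMap.adjoint_inner_right, hv, inner_zero_left]
      refine ⟨⟨w, hwW⟩, hw, ext_inner_left ℂ fun v => ?_⟩
      rw [ContinuousLinearMap.adjoint_inner_right]
      refine (Submodule.inner_orthogonalProjectionOnto_eq_of_mem_left v _).trans ?_
      change inner ℂ (v : V) (A w) = inner ℂ (j v) f
      rw [hf, ContinuousLinearMap.adjoint_inner_right]
    · rintro ⟨w, hw, hf⟩
      refine ⟨w, hw, ext_inner_left ℂ fun v => ?_⟩
      have h1 : inner ℂ (P v : V) (A w) = inner ℂ (j (P v)) f := by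
        have := congrArg (inner ℂ (P v)) hf
        rw [ContinuousLinearMap.adjoint_inner_right] at this
        exact (Submodule.inner_orthogonalProjectionOnto_eq_of_mem_left (P v) _).symm.trans this
      rw [hP, map_sub, hQ.map_eq_zero, sub_zero, inner_sub_left, w.2 _ (hQ.map_eq_zero v),
        sub_zero] at h1
      rw [h1, ContinuousLinearMap.adjoint_inner_right]
  have hcl : c.IsClosable := hW.isClosable_of_represents hinj hrep
  have hreg : SesqForm.IsRegularPart a (a.regularPart) :=
    Classical.epsilon_spec ⟨c, ⟨γ, hrep.isVertex hW⟩, hcl, hgraph⟩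
  have heq : a.regularPart = c :=
    hreg.2.1.eq_of_operatorGraph hcl fun x f => (hreg.2.2 x f).symm.trans (hgraph x f)
  rw [heq]; rfl

theorem singularPart_apply_self (hQ : IsKernelProjection A j Q) (h : IsElliptic A j γ)
    (ha : Represents a Φ A j) (u : D) :
    a.singularPart u u = inner ℂ (Φ u) (A (Q (Φ u))) := by
  rw [SesqForm.singularPart, LinearMap.sub_apply, LinearMap.sub_apply,
    hQ.regularPart_apply h ha, ← ha.form, inner_sub_left,
    hQ.inner_eq_zero _ _ (hQ.map_eq_zero _), sub_zero, map_sub, inner_sub_right]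
  ring

end IsKernelProjection

end

/-! ### The criterion for the singular part -/

/-- Perturbing a number `c` with real part `p²` by at most `2 p t + t²` leads out of a sector only
up to a shift by `4 t²`. -/
theorem re_le_and_abs_im_le_of_norm_sub_le {z c : ℂ} {p t N : ℝ}
    (hN : 0 ≤ N) (hre : c.re = p ^ 2) (hc : ‖c‖ ≤ N * p ^ 2)
    (hz : ‖z - c‖ ≤ 2 * (p * t) + t ^ 2) :
    p ^ 2 / 2 + t ^ 2 ≤ z.re + 4 * t ^ 2 ∧ |z.im| ≤ (2 * N + 2) * (p ^ 2 / 2 + t ^ 2) := by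
  have h1 : |(z - c).re| ≤ 2 * (p * t) + t ^ 2 := (Complex.abs_re_le_norm _).trans hz
  have h2 : |(z - c).im| ≤ 2 * (p * t) + t ^ 2 := (Complex.abs_im_le_norm _).trans hz
  have h3 : |c.im| ≤ N * p ^ 2 := (Complex.abs_im_le_norm _).trans hc
  rw [Complex.sub_re, hre] at h1
  rw [Complex.sub_im] at h2
  constructor
  · nlinarith [(abs_le.1 h1).1, sq_nonneg (p - 2 * t)]
  · have h4 : |z.im| ≤ |z.im - c.im| + |c.im| := by
      simpa using abs_add_le (z.im - c.im) c.im
    nlinarith [sq_nonneg (p - t), mul_nonneg hN (sq_nonneg t), sq_nonneg t]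

section

variable {H : Type*} [NormedAddCommGroup H] [InnerProductSpace ℂ H] [CompleteSpace H]
variable {V : Type*} [NormedAddCommGroup V] [InnerProductSpace ℂ V] [CompleteSpace V]
variable {A Q : V →L[ℂ] V} {j : V →L[ℂ] H} {γ : ℝ} {T : V →L[ℂ] j.ker}

/-- The defining relation of `T`, solved for the form: against vectors of `ker j` the real part of
the form is the inner product of `V`. -/
theorem IsElliptic.inner_apply_of_imag (h : IsElliptic A j γ)
    (hT : ∀ (u : V) (v : j.ker),
      formIm (fun x y : V => inner ℂ y (A x)) u v
        = formRe (fun x y : V => inner ℂ y (A x)) (T u) v) (u : V) {v : V} (hv : j v = 0) :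
    inner ℂ v (A u) = inner ℂ v u + Complex.I * inner ℂ v (T u : V) ∧
      inner ℂ u (A v) = inner ℂ u v + Complex.I * inner ℂ (T u : V) v := by
  have h1 := hT u ⟨v, hv⟩
  have h2 := h.polarized u v
  have h3 := h.polarized (T u : V) v
  simp only [formIm, formRe, inner_conj_symm, hv, inner_zero_left, mul_zero, add_zero] at h1 h2 h3
  rw [h3, div_eq_div_iff (by simp) two_ne_zero] at h1
  have e1 : inner ℂ v (A u) = inner ℂ v u + Complex.I * inner ℂ v (T u : V) := by
    linear_combination h1 / 4 + h2 / 2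
  have e2 : inner ℂ (A v) u = inner ℂ v u - Complex.I * inner ℂ v (T u : V) := by
    linear_combination -h1 / 4 + h2 / 2
  refine ⟨e1, ?_⟩
  have e3 := congrArg conj e2
  rw [map_sub, map_mul, Complex.conj_I, inner_conj_symm, inner_conj_symm, inner_conj_symm] at e3
  linear_combination e3

/-- For `y` orthogonal to `ker j`, the vectors `Q y` and `T y` have comparable norms, and
`⟪y, A (Q y)⟫` is minus the conjugate of `⟪Q y, A (Q y)⟫`. -/
theorem IsKernelProjection.of_orthogonal (hQ : IsKernelProjection A j Q) (h : IsElliptic A j γ)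
    (hT : ∀ (u : V) (v : j.ker),
      formIm (fun x y : V => inner ℂ y (A x)) u v
        = formRe (fun x y : V => inner ℂ y (A x)) (T u) v) {y : V}
    (hy : ∀ v, j v = 0 → inner ℂ v y = 0) :
    (∀ v, j v = 0 → inner ℂ v (A (Q y)) = Complex.I * inner ℂ v (T y : V)) ∧
    (∀ v, j v = 0 → inner ℂ y (A v) = Complex.I * inner ℂ (T y : V) v) ∧
    (inner ℂ y (A (Q y))).re = -‖Q y‖ ^ 2 ∧
    ‖Q y‖ ≤ ‖T y‖ ∧ ‖T y‖ ≤ ‖A‖ * ‖Q y‖ := by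
  have e1 : ∀ v, j v = 0 → inner ℂ v (A (Q y)) = Complex.I * inner ℂ v (T y : V) := by
    intro v hv
    have h1 := hQ.inner_eq_zero y v hv
    rw [map_sub, inner_sub_right, (h.inner_apply_of_imag hT y hv).1, hy v hv] at h1
    linear_combination -h1
  have e2 : ∀ v, j v = 0 → inner ℂ y (A v) = Complex.I * inner ℂ (T y : V) v := by
    intro v hv
    rw [(h.inner_apply_of_imag hT y hv).2, ← inner_conj_symm, hy v hv, map_zero, zero_add]
  have hw := hQ.map_eq_zero y
  have hn := h.norm_sq_of_map_eq_zero hw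
  refine ⟨e1, e2, ?_, ?_, ?_⟩
  · rw [hn, e2 _ hw, e1 _ hw, Complex.I_mul_re, Complex.I_mul_re, neg_neg,
      ← inner_conj_symm (T y : V), Complex.conj_im, neg_neg]
  · have h1 : ‖Q y‖ ^ 2 ≤ ‖Q y‖ * ‖T y‖ := by
      rw [hn]
      refine (Complex.re_le_norm _).trans ?_
      rw [e1 _ hw, norm_mul, Complex.norm_I, one_mul]
      exact norm_inner_le_norm _ _
    rcases (norm_nonneg (Q y)).eq_or_lt with h0 | h0
    · rw [← h0]; exact norm_nonneg _
    · rw [sq] at h1; exact le_of_mul_le_mul_left h1 h0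
  · have h1 : ‖T y‖ ^ 2 ≤ ‖T y‖ * (‖A‖ * ‖Q y‖) := by
      have h2 := congrArg norm (e1 _ (T y).2)
      rw [norm_mul, Complex.norm_I, one_mul, inner_self_eq_norm_sq_to_K, norm_pow,
        RCLike.norm_ofReal, abs_norm] at h2
      change ‖(T y : V)‖ ^ 2 ≤ ‖(T y : V)‖ * _
      rw [← h2]
      refine (norm_inner_le_norm _ _).trans ?_
      gcongr
      exact A.le_opNorm _
    rcases (norm_nonneg (T y)).eq_or_lt with h0 | h0
    · rw [← h0]; positivity
    · rw [sq] at h1; exact le_of_mul_le_mul_left h1 h0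

/-- The criterion for the completed form given by an operator. -/
theorem Represents.isSectorial_singularPart_iff {D : Submodule ℂ H} {a : SesqForm D}
    {Φ : D →ₗ[ℂ] V} (ha : Represents a Φ A j) (h : IsElliptic A j γ)
    (hT : ∀ (u : V) (v : j.ker),
      formIm (fun x y : V => inner ℂ y (A x)) u v
        = formRe (fun x y : V => inner ℂ y (A x)) (T u) v) :
    a.singularPart.IsSectorial ↔
      ∃ M : ℝ, 0 < M ∧ ∀ u : D,
        ‖T (Φ u - j.ker.starProjection (Φ u))‖ ^ 2 ≤ M * ‖(u : H)‖ ^ 2 := by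
  obtain ⟨Q, hQ⟩ := h.exists_isKernelProjection
  have hs := hQ.singularPart_apply_self h ha
  have hproj : ∀ x, j (j.ker.starProjection x) = 0 := fun x =>
    j.ker.starProjection_apply_mem x
  have horth : ∀ x v, j v = 0 → inner ℂ v (x - j.ker.starProjection x) = 0 := fun x v hv =>
    (Submodule.mem_orthogonal _ _).1 (Submodule.sub_starProjection_mem_orthogonal x) v hv
  constructor
  · rintro ⟨δ, hδ⟩
    obtain ⟨K, hK⟩ := SesqForm.isVertex_iff.1 hδ
    -- the lower bound on the real part extends to all of `V` by density
    have hV : ∀ x, 0 ≤ (inner ℂ x (A (Q x))).re - δ * ‖j x‖ ^ 2 := fun x => by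
      have c1 : Continuous fun x : V => (inner ℂ x (A (Q x))).re :=
        Complex.continuous_re.comp (continuous_id.inner (by fun_prop))
      refine ha.dense.induction_on x (isClosed_le (by fun_prop) (by fun_prop)) fun u => ?_
      rw [← hs, ha.emb]
      exact (hK u).1
    refine ⟨‖A‖ ^ 2 * |δ| + 1, by positivity, fun u => ?_⟩
    -- `Φ u` without its component in `ker j` has the same image in `H`
    set y := Φ u - j.ker.starProjection (Φ u) with hy
    have hjy : j y = u := by rw [hy, map_sub, hproj, sub_zero, ha.emb]
    obtain ⟨-, -, h1, -, h2⟩ := hQ.of_orthogonal h hT (horth (Φ u))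
    have h3 := hV y
    rw [h1, hjy] at h3
    have h4 : ‖Q y‖ ^ 2 ≤ |δ| * ‖(u : H)‖ ^ 2 := by
      nlinarith [mul_le_mul_of_nonneg_right (neg_abs_le δ) (sq_nonneg ‖(u : H)‖)]
    calc ‖T y‖ ^ 2 ≤ (‖A‖ * ‖Q y‖) ^ 2 := by gcongr
      _ = ‖A‖ ^ 2 * ‖Q y‖ ^ 2 := mul_pow _ _ _
      _ ≤ ‖A‖ ^ 2 * (|δ| * ‖(u : H)‖ ^ 2) := by gcongr
      _ ≤ (‖A‖ ^ 2 * |δ| + 1) * ‖(u : H)‖ ^ 2 := by nlinarith [sq_nonneg ‖(u : H)‖]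
  · rintro ⟨M, hM, hTM⟩
    -- the shift by `4 M ‖u‖²` dominates `4 ‖T y‖²`
    refine ⟨-(4 * M), SesqForm.isVertex_iff.2 ⟨2 * ‖A‖ + 2, fun u => ?_⟩⟩
    have hMu := hTM u
    set p := j.ker.starProjection (Φ u) with hp
    set y := Φ u - p with hy
    have hjp : j p = 0 := hproj _
    obtain ⟨e1, e2, -, h1, -⟩ := hQ.of_orthogonal h hT (horth (Φ u))
    rw [← hp, ← hy] at e1 e2 h1
    have hw := hQ.map_eq_zero y
    have hsplit : a.singularPart u u - inner ℂ p (A p)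
        = inner ℂ p (A (Q y)) + inner ℂ y (A p) + inner ℂ y (A (Q y)) := by
      have hΦ : Φ u = p + y := by rw [hy]; abel
      rw [hs, hΦ, map_add, hQ.apply_of_map_eq_zero h hjp, map_add, inner_add_left,
        inner_add_right, inner_add_right]
      ring
    have herr : ‖a.singularPart u u - inner ℂ p (A p)‖ ≤ 2 * (‖p‖ * ‖T y‖) + ‖T y‖ ^ 2 := by
      rw [hsplit, e1 p hjp, e2 p hjp, e2 _ hw]
      refine (norm_add₃_le).trans ?_
      simp only [norm_mul, Complex.norm_I, one_mul]
      have b1 : ‖inner ℂ p (T y : V)‖ ≤ ‖p‖ * ‖T y‖ := norm_inner_le_norm _ _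
      have b2 : ‖inner ℂ (T y : V) p‖ ≤ ‖T y‖ * ‖p‖ := norm_inner_le_norm _ _
      have b3 : ‖inner ℂ (T y : V) (Q y)‖ ≤ ‖T y‖ * ‖Q y‖ := norm_inner_le_norm _ _
      nlinarith [mul_le_mul_of_nonneg_left h1 (norm_nonneg (T y))]
    have hAp : ‖inner ℂ p (A p)‖ ≤ ‖A‖ * ‖p‖ ^ 2 := by
      refine (norm_inner_le_norm _ _).trans ?_
      nlinarith [mul_le_mul_of_nonneg_left (A.le_opNorm p) (norm_nonneg p)]
    obtain ⟨b1, b2⟩ := re_le_and_abs_im_le_of_norm_sub_le (norm_nonneg A)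
      (h.norm_sq_of_map_eq_zero hjp).symm hAp herr
    have b3 : ‖p‖ ^ 2 / 2 + ‖T y‖ ^ 2
        ≤ (a.singularPart u u).re - -(4 * M) * ‖(u : H)‖ ^ 2 := by linarith
    exact ⟨le_trans (by positivity) b3, b2.trans (by gcongr)⟩

end

theorem lemma4p1 {H : Type*} [NormedAddCommGroup H] [InnerProductSpace ℂ H] [CompleteSpace H]
    (D : Submodule ℂ H) (hD : Dense (D : Set H))
    (a : SesqForm D) (γ : ℝ) (hγ : SesqForm.IsVertex a γ)
    -- the completion of the form domain for the form norm
    {V : Type*} [NormedAddCommGroup V] [InnerProductSpace ℂ V] [CompleteSpace V]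
    (Φ : D →ₗ[ℂ] V) (hΦ : SesqForm.IsCompletion a γ Φ)
    -- the continuous extensions of the form and of the embedding into `H`
    (aExt : V →L[ℂ] V →L⋆[ℂ] ℂ) (haExt : ∀ u v : D, aExt (Φ u) (Φ v) = a u v)
    (jExt : V →L[ℂ] H) (hjExt : ∀ u : D, jExt (Φ u) = (u : H))
    -- the operator `T` from `V` to the kernel of the extended embedding
    (T : V →L[ℂ] jExt.ker)
    (hT : ∀ (u : V) (v : jExt.ker),
      formIm (fun x y : V => aExt x y) u v = formRe (fun x y : V => aExt x y) (T u) v) :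
    SesqForm.IsSectorial (SesqForm.singularPart a) ↔
      ∃ M : ℝ, 0 < M ∧ ∀ u : D,
        ‖T (Φ u - jExt.ker.starProjection (Φ u))‖ ^ 2 ≤ M * ‖(u : H)‖ ^ 2 := by
  let A : V →L[ℂ] V := (continuousLinearMapOfBilin (𝕜 := ℂ) aExt.flip).adjoint
  have hA : ∀ u v, inner ℂ v (A u) = aExt u v := fun u v => by
    rw [ContinuousLinearMap.adjoint_inner_right, continuousLinearMapOfBilin_apply,
      ContinuousLinearMap.flip_apply]
  have hrep : Represents a Φ A jExt := ⟨hΦ.2, fun u v => by rw [hA, haExt], hjExt⟩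
  refine hrep.isSectorial_singularPart_iff (hrep.isElliptic_of_isVertex hΦ.1 hγ) ?_
  simpa only [hA] using hT
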